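/- Let $F$ be a (real) Banach lattice with order continuous norm, i.e. every net $x_\alpha\downarrow 0$ in $F$ satisfies $\|x_\alpha\|\to 0$. A filtration on $F$ is a sequence $(E_n)$ of positive linear projections on $F$ such that $E_nE_m=E_{n\wedge m}$ for all $n,m$; it is uniformly bounded if $\sup_n\|E_n\|<\infty$. For a filtration $(E_n)$, let $M=M(F,(E_n))$ be the space of all bounded martingales, i.e. of all sequences $X=(x_n)$ in $F$ such that $E_nx_m=x_n$ whenever $m\ge n$ and $\sup_n\|x_n\|<\infty$, ordered coordinatewise; let $M_+$ be its positive cone and let $M_r=\{X_1-X_2 : X_1,X_2\in M_+\}$ be the space of regular bounded martingales. Then the following are equivalent: (1) $F$ is a KB-space, i.e. $F$ contains no sublattice isomorphic to $c_0$ (linearly, topologically and as a lattice); (2) $M=M_r$ for every uniformly bounded filtration $(E_n)$ on $F$; (3) $M$ is a vector lattice (in the coordinatewise order) for every uniformly bounded filtration $(E_n)$ on $F$. -/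

import Mathlib

open Filter Topology
open scoped ZeroAtInfty

universe u

namespace AbstractMartingale

section Filtrations

variable {F : Type u} [AddCommGroup F] [Lattice F] [Module ℝ F]

/-- A filtration on a vector lattice: a sequence of positive linear projections with
`E n ∘ E m = E (min n m)`. -/
structure IsFiltration (E : ℕ → F →ₗ[ℝ] F) : Prop where
  positive : ∀ n x, 0 ≤ x → 0 ≤ E n x
  projection : ∀ n x, E n (E n x) = E n x
  comp : ∀ n m x, E n (E m x) = E (min n m) x

/-- The sequence `X` is a martingale with respect to `E`. -/
def IsMartingale (E : ℕ → F →ₗ[ℝ] F) (X : ℕ → F) : Prop :=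
  ∀ n m, n ≤ m → E n (X m) = X n

end Filtrations

section Bounded

variable {F : Type u} [NormedAddCommGroup F] [Lattice F] [NormedSpace ℝ F]

/-- `sup ‖E n‖ < ∞`: all `E n` are bounded operators, with a common bound for their operator
norms. -/
def IsUniformlyBounded (E : ℕ → F →ₗ[ℝ] F) : Prop :=
  ∃ C : ℝ, ∀ n x, ‖E n x‖ ≤ C * ‖x‖

/-- The space `M` of all norm bounded martingales, as a subspace of the space of all sequences.
The order it inherits from `ℕ → F` is the coordinatewise one. -/
def boundedMartingales (E : ℕ → F →ₗ[ℝ] F) : Submodule ℝ (ℕ → F) where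
  carrier := {X | IsMartingale E X ∧ ∃ C : ℝ, ∀ n, ‖X n‖ ≤ C}
  zero_mem' := ⟨fun n m _ => by simp, 0, fun n => by simp⟩
  add_mem' := by
    rintro X Y ⟨hX, C, hC⟩ ⟨hY, D, hD⟩
    refine ⟨fun n m h => ?_, C + D, fun n => ?_⟩
    · simp [hX n m h, hY n m h]
    · exact (norm_add_le _ _).trans (add_le_add (hC n) (hD n))
  smul_mem' := by
    rintro c X ⟨hX, C, hC⟩
    refine ⟨fun n m h => ?_, ‖c‖ * C, fun n => ?_⟩
    · simp [hX n m h]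
    · rw [Pi.smul_apply, norm_smul]
      exact mul_le_mul_of_nonneg_left (hC n) (norm_nonneg c)

/-- The space `M_r` of regular bounded martingales: all differences of positive elements
of `M`. -/
def regularBoundedMartingales (E : ℕ → F →ₗ[ℝ] F) : Set (ℕ → F) :=
  {X | ∃ X₁ ∈ boundedMartingales E, ∃ X₂ ∈ boundedMartingales E,
    0 ≤ X₁ ∧ 0 ≤ X₂ ∧ X = X₁ - X₂}

end Bounded

/-- A subspace `V` of an ordered vector space is a vector lattice in its own right, under the
inherited order: any two elements have a supremum and an infimum in `V` (where bounds are taken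
within `V`). -/
def IsVectorLattice {W : Type u} [AddCommGroup W] [PartialOrder W] [Module ℝ W]
    (V : Submodule ℝ W) : Prop :=
  ∀ X Y : V, (∃ Z : V, IsLUB {X, Y} Z) ∧ (∃ Z : V, IsGLB {X, Y} Z)

section BanachLattice

variable (F : Type u) [NormedAddCommGroup F] [Lattice F] [NormedSpace ℝ F]

/-- Order continuity of the norm: every net decreasing to `0` in order converges to `0` in
norm. -/
def HasOrderContinuousNorm : Prop :=
  ∀ (ι : Type u) [Preorder ι] [IsDirectedOrder ι] [Nonempty ι] (x : ι → F),
    Antitone x → IsGLB (Set.range x) 0 → Tendsto x atTop (𝓝 0)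

/-- `F` is a KB-space: it has no vector sublattice `G` isomorphic to `c₀`, where an isomorphism
is a linear homeomorphism that preserves the order in both directions (and so all lattice
operations). Here `c₀` is `C₀(ℕ, ℝ)`, the real sequences tending to `0` with the sup norm, and is
ordered coordinatewise. -/
def IsKBSpace : Prop :=
  ¬ ∃ G : Submodule ℝ F, (∀ x ∈ G, ∀ y ∈ G, x ⊔ y ∈ G ∧ x ⊓ y ∈ G) ∧
    ∃ e : C₀(ℕ, ℝ) ≃L[ℝ] G, ∀ f g : C₀(ℕ, ℝ), e f ≤ e g ↔ ∀ n, f n ≤ g n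

end BanachLattice

end AbstractMartingale

/-!
Write "bounded increasing sequences converge" for the statement that every norm bounded increasing
sequence in `F` is norm convergent. The proof passes through disjoint sequences `v` of positive
elements that are bounded away from `0` but have norm bounded partial sums (`IsC0Sequence`).
Their closed spans are exactly the sublattice copies of `c₀` in `F`
(`IsC0Sequence.not_isKBSpace`, `exists_isC0Sequence_of_not_isKBSpace`).

If `F` contains no such `v`, then bounded increasing sequences converge
(`HasOrderContinuousNorm.exists_isC0Sequence`). Indeed, a divergent one has steps `u n` that are
bounded away from `0`. Order continuity makes order bounded increasing sequences converge, and a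
truncation argument then gives `u n ⊓ w → 0` for each fixed `w ≥ 0`. A gliding hump extracts an
almost disjoint subsequence of `u`, which `IsC0Sequence.of_almost_disjoint` makes disjoint.
Once bounded increasing sequences converge, the supremum of two bounded martingales `X` and `Y`
has `lim_m E n (X m ⊔ Y m)` as its `n`-th term, so `M` is a vector lattice
(`exists_isLUB_boundedMartingales`). A vector lattice is spanned by its positive cone, so `M = M_r`.

Conversely, let `v` be such a sequence. Order continuity and the Hahn–Banach theorem give positive
coordinate functionals `g k` with `g k x → 0` for every `x`
(`IsC0Sequence.exists_isCoordinateSystem`), hence a positive projection onto the copy of `c₀`.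
Averaging the pairs of coordinates `2 k`, `2 k + 1` with `k ≥ n` defines a uniformly bounded
filtration. The martingale `X m = ∑_{k < 2 m} (-1)ᵏ v k` is bounded, but each positive martingale
above it starts with an element whose coordinates do not tend to `0`, so `X` is not regular
(`IsC0Sequence.exists_not_regular`).
-/

namespace AbstractMartingale

/-! ### Disjoint elements of a vector lattice -/

section VectorLattice

theorem smul_inf_smul {F : Type u} [AddCommGroup F] [Lattice F] [Module ℝ F] [IsOrderedModule ℝ F]
    {c : ℝ} (hc : 0 < c) (x y : F) : (c • x) ⊓ (c • y) = c • (x ⊓ y) :=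
  ((OrderIso.smulRight hc).map_inf x y).symm

variable {F : Type u} [AddCommGroup F] [Lattice F] [IsOrderedAddMonoid F]

theorem add_inf_le_inf_add_inf {x y e : F} (hx : 0 ≤ x) (hy : 0 ≤ y) (he : 0 ≤ e) :
    (x + y) ⊓ e ≤ x ⊓ e + y ⊓ e := by
  rw [add_inf, inf_add, inf_add]
  refine le_inf (le_inf inf_le_left ?_) (le_inf ?_ ?_)
  · exact inf_le_right.trans (le_add_of_nonneg_right hy)
  · exact inf_le_right.trans (le_add_of_nonneg_left hx)
  · exact inf_le_right.trans (le_add_of_nonneg_right he)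

theorem sum_inf_eq_zero {ι : Type*} (s : Finset ι) {x : ι → F} {e : F}
    (hx : ∀ i ∈ s, 0 ≤ x i) (he : 0 ≤ e) (h : ∀ i ∈ s, x i ⊓ e = 0) : (∑ i ∈ s, x i) ⊓ e = 0 := by
  classical
  induction s using Finset.induction_on with
  | empty => simpa using he
  | insert i s hi ih =>
    rw [Finset.sum_insert hi]
    have hs : 0 ≤ ∑ i ∈ s, x i := Finset.sum_nonneg fun j hj => hx j (Finset.mem_insert_of_mem hj)
    have hxi := hx i (Finset.mem_insert_self i s)
    refine le_antisymm ((add_inf_le_inf_add_inf hxi hs he).trans ?_)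
      (le_inf (add_nonneg hxi hs) he)
    rw [h i (Finset.mem_insert_self i s), ih (fun j hj => hx j (Finset.mem_insert_of_mem hj))
      fun j hj => h j (Finset.mem_insert_of_mem hj), add_zero]

/-- A sum of pairwise disjoint elements is their supremum, so it obeys every upper bound that
the summands have in common. -/
theorem sum_range_le_of_disjoint {d : ℕ → F} (hd0 : ∀ n, 0 ≤ d n)
    (hd : ∀ i j, i ≠ j → d i ⊓ d j = 0) {u : F} (hu : ∀ n, d n ≤ u) (n : ℕ) :
    ∑ k ∈ Finset.range n, d k ≤ u := by
  induction n with
  | zero => simpa using (hd0 0).trans (hu 0)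
  | succ n ih =>
    have h := sum_inf_eq_zero (Finset.range n) (fun i _ => hd0 i) (hd0 n)
      (fun i hi => hd i n (Finset.mem_range.1 hi).ne)
    rw [Finset.sum_range_succ, ← inf_add_sup, h, zero_add]
    exact sup_le ih (hu n)

theorem posPart_sub_inf_posPart_sub {x y : F} : (x - y)⁺ ⊓ (y - x)⁺ = 0 := by
  rw [← neg_sub x y, posPart_neg, posPart_inf_negPart_eq_zero]

variable [Module ℝ F] [IsOrderedModule ℝ F]

theorem smul_inf_smul_eq_zero {x y : F} (hx : 0 ≤ x) (hy : 0 ≤ y) (h : x ⊓ y = 0) {a b : ℝ}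
    (ha : 0 ≤ a) (hb : 0 ≤ b) : (a • x) ⊓ (b • y) = 0 := by
  refine le_antisymm ?_ (le_inf (smul_nonneg ha hx) (smul_nonneg hb hy))
  have hc : 0 < a + b + 1 := by positivity
  calc (a • x) ⊓ (b • y) ≤ ((a + b + 1) • x) ⊓ ((a + b + 1) • y) :=
        inf_le_inf (smul_le_smul_of_nonneg_right (by linarith) hx)
          (smul_le_smul_of_nonneg_right (by linarith) hy)
    _ = 0 := by rw [smul_inf_smul hc, h, smul_zero]

theorem sum_smul_inf_sum_smul_eq_zero {ι : Type*} (s : Finset ι) {v : ι → F}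
    (hv : ∀ i, 0 ≤ v i) (hd : ∀ i j, i ≠ j → v i ⊓ v j = 0) {a b : ι → ℝ}
    (ha : ∀ i, 0 ≤ a i) (hb : ∀ i, 0 ≤ b i) (hab : ∀ i, a i ⊓ b i = 0) :
    (∑ i ∈ s, a i • v i) ⊓ (∑ i ∈ s, b i • v i) = 0 := by
  refine sum_inf_eq_zero s (fun i _ => smul_nonneg (ha i) (hv i))
    (Finset.sum_nonneg fun i _ => smul_nonneg (hb i) (hv i)) fun i _ => ?_
  rw [inf_comm]
  refine sum_inf_eq_zero s (fun j _ => smul_nonneg (hb j) (hv j)) (smul_nonneg (ha i) (hv i))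
    fun j _ => ?_
  rcases eq_or_ne j i with rfl | hji
  · rcases le_total (a j) (b j) with h | h
    · have : a j = 0 := by rw [← hab j, inf_eq_left.2 h]
      simpa [this] using smul_nonneg (hb j) (hv j)
    · have : b j = 0 := by rw [← hab j, inf_eq_right.2 h]
      simpa [this] using smul_nonneg (ha j) (hv j)
  · exact smul_inf_smul_eq_zero (hv j) (hv i) (hd j i hji) (hb j) (ha i)

theorem abs_sum_smul {ι : Type*} (s : Finset ι) {v : ι → F}
    (hv : ∀ i, 0 ≤ v i) (hd : ∀ i j, i ≠ j → v i ⊓ v j = 0) (a : ι → ℝ) :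
    |∑ i ∈ s, a i • v i| = ∑ i ∈ s, |a i| • v i := by
  have h0 := sum_smul_inf_sum_smul_eq_zero s hv hd (fun i => posPart_nonneg (a i))
    (fun i => negPart_nonneg (a i)) (fun i => posPart_inf_negPart_eq_zero (a i))
  have h1 : ∑ i ∈ s, a i • v i = ∑ i ∈ s, (a i)⁺ • v i - ∑ i ∈ s, (a i)⁻ • v i := by
    rw [← Finset.sum_sub_distrib]
    exact Finset.sum_congr rfl fun i _ => by rw [← sub_smul, posPart_sub_negPart]
  have h2 : ∑ i ∈ s, |a i| • v i = ∑ i ∈ s, (a i)⁺ • v i + ∑ i ∈ s, (a i)⁻ • v i := by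
    rw [← Finset.sum_add_distrib]
    exact Finset.sum_congr rfl fun i _ => by rw [← add_smul, posPart_add_negPart]
  rw [h1, h2, abs_sub_comm, ← sup_sub_inf_eq_abs_sub, ← inf_add_sup, h0, sub_zero, zero_add]

/-- An inequality that turns the truncations `a ⊓ w` of the steps of an increasing sequence into
steps of a truncated, hence order bounded, increasing sequence, up to an error `b / K`. -/
theorem sub_inf_le {a b w : F} (hb : 0 ≤ b) (hw : 0 ≤ w) {K : ℝ} (hK : 1 ≤ K) :
    (b - a) ⊓ w ≤ b ⊓ (K • w) - a ⊓ (K • w) + K⁻¹ • b := by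
  have hK0 : 0 < K := by linarith
  have hK1 : K⁻¹ ≤ 1 := inv_le_one_of_one_le₀ hK
  set z := (b - a) ⊓ w + a ⊓ (K • w) with hz
  have h1 : z ≤ b := by
    calc z ≤ (b - a) + a := add_le_add inf_le_left inf_le_left
      _ = b := by abel
  have h2 : z ≤ (1 + K) • w := by
    calc z ≤ w + K • w := add_le_add inf_le_right inf_le_right
      _ = (1 + K) • w := by rw [add_smul, one_smul]
  have h3 : z ≤ b ⊓ (K • w) + K⁻¹ • b := by
    rw [inf_add]
    refine le_inf (h1.trans (le_add_of_nonneg_right (smul_nonneg (by positivity) hb))) ?_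
    -- `z` is the convex combination of its two upper bounds with weights `K⁻¹` and `1 - K⁻¹`
    calc z = K⁻¹ • z + (1 - K⁻¹) • z := by rw [← add_smul]; simp
      _ ≤ K⁻¹ • b + (1 - K⁻¹) • ((1 + K) • w) :=
        add_le_add (smul_le_smul_of_nonneg_left h1 (by positivity))
          (smul_le_smul_of_nonneg_left h2 (by linarith))
      _ ≤ K • w + K⁻¹ • b := by
        rw [smul_smul, add_comm]
        refine add_le_add_left (smul_le_smul_of_nonneg_right ?_ hw) _
        have : (1 - K⁻¹) * (1 + K) = K - K⁻¹ := by field_simp; ring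
        rw [this]
        linarith [inv_pos.2 hK0]
  calc (b - a) ⊓ w = z - a ⊓ (K • w) := by rw [hz]; abel
    _ ≤ b ⊓ (K • w) + K⁻¹ • b - a ⊓ (K • w) := sub_le_sub_right h3 _
    _ = _ := by abel

end VectorLattice

/-! ### Consequences of order continuity of the norm -/

section OrderContinuous

variable {F : Type u} [NormedAddCommGroup F] [Lattice F] [IsOrderedAddMonoid F] [HasSolidNorm F]

theorem norm_le_norm_of_nonneg_of_le {x y : F} (hx : 0 ≤ x) (hxy : x ≤ y) : ‖x‖ ≤ ‖y‖ :=
  norm_le_norm_of_abs_le_abs (abs_le_abs_of_nonneg hx hxy)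

theorem norm_sum_range_le {v : ℕ → F} (hv : ∀ n, 0 ≤ v n) {C : ℝ}
    (hC : ∀ n, ‖∑ k ∈ Finset.range n, v k‖ ≤ C) (s : Finset ℕ) : ‖∑ k ∈ s, v k‖ ≤ C := by
  obtain ⟨n, hn⟩ := s.exists_nat_subset_range
  exact (norm_le_norm_of_nonneg_of_le (Finset.sum_nonneg fun i _ => hv i)
    (Finset.sum_le_sum_of_subset_of_nonneg hn fun i _ _ => hv i)).trans (hC n)

variable [NormedSpace ℝ F] [IsOrderedModule ℝ F]

/-- Normed vector lattices are Archimedean. -/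
theorem nonpos_of_forall_nsmul_le {z w : F} (h : ∀ n : ℕ, n • z ≤ w) : z ≤ 0 := by
  have ht : Tendsto (fun n : ℕ => ((n : ℝ) + 1)⁻¹ • w) atTop (𝓝 0) := by
    simpa using (tendsto_one_div_add_atTop_nhds_zero_nat (𝕜 := ℝ)).smul_const w
  refine ge_of_tendsto' ht fun n => ?_
  have hn : (0 : ℝ) < (n : ℝ) + 1 := by positivity
  rw [le_inv_smul_iff_of_pos hn]
  simpa [← Nat.cast_smul_eq_nsmul ℝ] using h (n + 1)

/-- The differences `y - x n`, with `y` running over the upper bounds of `x`, form a net that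
decreases to `0`, because `F` is Archimedean. -/
theorem HasOrderContinuousNorm.cauchySeq_of_monotone (hF : HasOrderContinuousNorm F)
    {x : ℕ → F} (hx : Monotone x) {u : F} (hu : ∀ n, x n ≤ u) : CauchySeq x := by
  -- indexing by the negatives of the upper bounds directs the net upwards
  let D := {p : F × ℕ // ∀ n, x n ≤ -p.1}
  have hne : Nonempty D := ⟨⟨(-u, 0), by simpa using hu⟩⟩
  have hdir : IsDirectedOrder D := ⟨by
    rintro ⟨⟨y, m⟩, hp⟩ ⟨⟨z, n⟩, hq⟩
    refine ⟨⟨(y ⊔ z, m ⊔ n), fun k => ?_⟩, ?_, ?_⟩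
    · rw [neg_sup]
      exact le_inf (hp k) (hq k)
    · exact ⟨le_sup_left, le_sup_left⟩
    · exact ⟨le_sup_right, le_sup_right⟩⟩
  have hanti : Antitone fun p : D => -p.1.1 - x p.1.2 := fun p q h =>
    sub_le_sub (neg_le_neg h.1) (hx h.2)
  have hglb : IsGLB (Set.range fun p : D => -p.1.1 - x p.1.2) 0 := by
    refine ⟨?_, fun z hz => ?_⟩
    · rintro _ ⟨p, rfl⟩
      exact sub_nonneg.2 (p.2 p.1.2)
    · -- subtracting `z` from an upper bound of `x` gives an upper bound of `x`
      have hz' : ∀ y : F, (∀ n, x n ≤ y) → ∀ n, x n ≤ y - z := by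
        intro y hy n
        have h : z ≤ - -y - x n := hz ⟨⟨(-y, n), by simpa using hy⟩, rfl⟩
        rw [neg_neg] at h
        exact le_sub_comm.1 h
      have hk : ∀ k n : ℕ, x n ≤ u - k • z := by
        intro k
        induction k with
        | zero => simpa using hu
        | succ k ih =>
          intro n
          have h := hz' _ ih n
          rwa [sub_sub, ← succ_nsmul] at h
      exact nonpos_of_forall_nsmul_le fun k => le_sub_comm.1 (hk k 0)
  have ht := hF D _ hanti hglb
  rw [Metric.cauchySeq_iff']
  intro ε hε
  have hev : ∀ᶠ p : D in atTop, dist (-p.1.1 - x p.1.2) 0 < ε / 2 :=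
    ht (Metric.ball_mem_nhds 0 (half_pos hε))
  obtain ⟨p, hp⟩ := eventually_atTop.1 hev
  set y := p.1.1
  set N := p.1.2
  have key : ∀ n, N ≤ n → ‖-y - x n‖ < ε / 2 := fun n hn => by
    simpa using hp ⟨(y, n), p.2⟩ ⟨le_rfl, hn⟩
  refine ⟨N, fun n hn => ?_⟩
  rw [dist_eq_norm]
  calc ‖x n - x N‖ = ‖(-y - x N) - (-y - x n)‖ := by congr 1; abel
    _ ≤ ‖-y - x N‖ + ‖-y - x n‖ := norm_sub_le _ _
    _ < ε := by linarith [key n hn, key N le_rfl]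

theorem tendsto_succ_sub_of_cauchySeq {E : Type*} [SeminormedAddCommGroup E] {x : ℕ → E}
    (hx : CauchySeq x) :
    Tendsto (fun n => x (n + 1) - x n) atTop (𝓝 0) := by
  rw [Metric.tendsto_atTop]
  intro ε hε
  obtain ⟨N, hN⟩ := Metric.cauchySeq_iff.1 hx ε hε
  exact ⟨N, fun n hn => by
    simpa [dist_eq_norm] using hN (n + 1) (by omega) n hn⟩

theorem HasOrderContinuousNorm.tendsto_zero_of_disjoint (hF : HasOrderContinuousNorm F)
    {d : ℕ → F} (hd0 : ∀ n, 0 ≤ d n) (hd : ∀ i j, i ≠ j → d i ⊓ d j = 0) {u : F}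
    (hu : ∀ n, d n ≤ u) : Tendsto d atTop (𝓝 0) := by
  have hm : Monotone fun n => ∑ k ∈ Finset.range n, d k :=
    monotone_nat_of_le_succ fun n => by
      rw [Finset.sum_range_succ]
      exact le_add_of_nonneg_right (hd0 n)
  have h := tendsto_succ_sub_of_cauchySeq
    (hF.cauchySeq_of_monotone hm (sum_range_le_of_disjoint hd0 hd hu))
  simpa [Finset.sum_range_succ] using h

/-- The truncated steps of a norm bounded increasing sequence tend to `0`, although the steps
themselves need not. -/
theorem HasOrderContinuousNorm.tendsto_sub_inf (hF : HasOrderContinuousNorm F)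
    {x : ℕ → F} (hx : Monotone x) (hx0 : ∀ n, 0 ≤ x n) {C : ℝ} (hC : ∀ n, ‖x n‖ ≤ C) {w : F}
    (hw : 0 ≤ w) : Tendsto (fun n => (x (n + 1) - x n) ⊓ w) atTop (𝓝 0) := by
  rw [Metric.tendsto_atTop]
  intro ε hε
  have hC0 : 0 ≤ C := (norm_nonneg _).trans (hC 0)
  set K : ℝ := 2 * C / ε + 1 with hK
  have hK1 : 1 ≤ K := by rw [hK]; linarith [show 0 ≤ 2 * C / ε by positivity]
  have hK0 : 0 < K := by linarith
  have hKC : K⁻¹ * C < ε / 2 := by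
    rw [inv_mul_lt_iff₀ hK0, hK]
    field_simp
    linarith
  have hc : CauchySeq fun n => x n ⊓ (K • w) :=
    hF.cauchySeq_of_monotone (fun m n h => inf_le_inf_right _ (hx h)) (fun n => inf_le_right)
  obtain ⟨N, hN⟩ :=
    Metric.tendsto_atTop.1 (tendsto_succ_sub_of_cauchySeq hc) (ε / 2) (half_pos hε)
  refine ⟨N, fun n hn => ?_⟩
  have h1 := hN n hn
  rw [dist_zero_right] at h1 ⊢
  calc ‖(x (n + 1) - x n) ⊓ w‖
      ≤ ‖x (n + 1) ⊓ (K • w) - x n ⊓ (K • w) + K⁻¹ • x (n + 1)‖ :=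
        norm_le_norm_of_nonneg_of_le (le_inf (sub_nonneg.2 (hx n.le_succ)) hw)
          (sub_inf_le (hx0 _) hw hK1)
    _ ≤ ‖x (n + 1) ⊓ (K • w) - x n ⊓ (K • w)‖ + ‖K⁻¹ • x (n + 1)‖ := norm_add_le _ _
    _ ≤ ‖x (n + 1) ⊓ (K • w) - x n ⊓ (K • w)‖ + K⁻¹ * C := by
        rw [norm_smul, Real.norm_of_nonneg (inv_nonneg.2 hK0.le)]
        gcongr
        exact hC _
    _ < ε := by linarith

end OrderContinuous

/-! ### Disjoint sequences equivalent to the basis of `c₀` -/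

section C0Sequence

variable {F : Type u} [NormedAddCommGroup F] [Lattice F]

/-- A disjoint sequence of positive elements that behaves like the unit vector basis of `c₀`:
its members are bounded away from `0` in norm, while its partial sums are norm bounded. -/
structure IsC0Sequence (v : ℕ → F) : Prop where
  nonneg : ∀ n, 0 ≤ v n
  disjoint : ∀ i j, i ≠ j → v i ⊓ v j = 0
  exists_le_norm : ∃ ε : ℝ, 0 < ε ∧ ∀ n, ε ≤ ‖v n‖
  exists_norm_sum_le : ∃ C : ℝ, ∀ n, ‖∑ k ∈ Finset.range n, v k‖ ≤ C

variable [IsOrderedAddMonoid F]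

/-- The steps of a suitable subsequence of a divergent increasing sequence are bounded away from
`0`, and their partial sums telescope. -/
theorem exists_nonneg_of_not_cauchySeq {x : ℕ → F} (hx : Monotone x) {C : ℝ}
    (hC : ∀ n, ‖x n‖ ≤ C) (hn : ¬ CauchySeq x) :
    ∃ u : ℕ → F, (∀ n, 0 ≤ u n) ∧ (∃ ε : ℝ, 0 < ε ∧ ∀ n, ε ≤ ‖u n‖) ∧
      ∃ B : ℝ, ∀ n, ‖∑ k ∈ Finset.range n, u k‖ ≤ B := by
  rw [Metric.cauchySeq_iff'] at hn
  push Not at hn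
  obtain ⟨ε, hε, h⟩ := hn
  choose g hg hgε using h
  let φ : ℕ → ℕ := fun k => g^[k] 0
  have hφ : ∀ k, φ (k + 1) = g (φ k) := fun k => Function.iterate_succ_apply' g k 0
  refine ⟨fun k => x (φ (k + 1)) - x (φ k), fun k => ?_, ⟨ε, hε, fun k => ?_⟩, C + C, fun n => ?_⟩
  · beta_reduce
    rw [hφ]
    exact sub_nonneg.2 (hx (hg _))
  · beta_reduce
    rw [hφ, ← dist_eq_norm]
    exact hgε _
  · rw [Finset.sum_range_sub fun k => x (φ k)]
    exact (norm_sub_le _ _).trans (add_le_add (hC _) (hC _))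

variable [HasSolidNorm F] [NormedSpace ℝ F] [IsOrderedModule ℝ F]

/-- A subsequence `n ↦ u (φ n)` along which each term is almost disjoint from a prescribed, possibly
large, multiple of the sum of the earlier ones. -/
theorem HasOrderContinuousNorm.exists_strictMono_inf_lt (hF : HasOrderContinuousNorm F)
    {u : ℕ → F} (hu : ∀ n, 0 ≤ u n) {C : ℝ} (hC : ∀ n, ‖∑ k ∈ Finset.range n, u k‖ ≤ C)
    (M : ℕ → ℝ) (hM : ∀ n, 0 ≤ M n) {η : ℝ} (hη : 0 < η) :
    ∃ φ : ℕ → ℕ, StrictMono φ ∧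
      ∀ j, ‖u (φ (j + 1)) ⊓ (M j • ∑ k ∈ Finset.range (φ j + 1), u k)‖ < η := by
  have hsum : ∀ n, 0 ≤ ∑ k ∈ Finset.range n, u k := fun n => Finset.sum_nonneg fun i _ => hu i
  have hmono : Monotone fun n => ∑ k ∈ Finset.range n, u k :=
    monotone_nat_of_le_succ fun n => by
      rw [Finset.sum_range_succ]
      exact le_add_of_nonneg_right (hu n)
  have hstep : ∀ j n : ℕ, ∃ m, n < m ∧ ‖u m ⊓ (M j • ∑ k ∈ Finset.range (n + 1), u k)‖ < η := by
    intro j n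
    have ht := hF.tendsto_sub_inf hmono hsum hC (smul_nonneg (hM j) (hsum (n + 1)))
    have hev := ht.norm.eventually (gt_mem_nhds (show ‖(0 : F)‖ < η by simpa using hη))
    obtain ⟨m, hm, hnm⟩ := (hev.and (eventually_gt_atTop n)).exists
    refine ⟨m, hnm, ?_⟩
    simpa [Finset.sum_range_succ] using hm
  choose g hg hgη using hstep
  let φ : ℕ → ℕ := fun n => Nat.rec 0 g n
  exact ⟨φ, strictMono_nat_of_lt_succ fun j => hg j (φ j), fun j => hgη j (φ j)⟩

/-- If each `a j` is almost disjoint from `w j`, which dominates large multiples of all earlier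
`a i`, then cutting `w j` and a small multiple of `∑ 2⁻ⁱ a i` off `a j` makes the sequence
disjoint without making its members small. -/
theorem IsC0Sequence.of_almost_disjoint [CompleteSpace F] {a w : ℕ → F} (ha : ∀ n, 0 ≤ a n)
    (hw : ∀ n, 0 ≤ w n) {C ε : ℝ} (hC : 0 < C) (hε : 0 < ε)
    (haC : ∀ n, ‖∑ k ∈ Finset.range n, a k‖ ≤ C) (haε : ∀ n, ε ≤ ‖a n‖)
    (haw : ∀ n, ‖a n ⊓ w n‖ ≤ ε / 4)
    (hwa : ∀ i j, i < j → ((8 * C / ε) * 2 ^ j) • a i ≤ w j) :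
    ∃ v : ℕ → F, IsC0Sequence v := by
  have haC' : ∀ n, ‖a n‖ ≤ C := fun n => by simpa using norm_sum_range_le ha haC {n}
  have hbound : ∀ n, ‖((1 / 2 : ℝ) ^ n) • a n‖ ≤ (1 / 2 : ℝ) ^ n * C := fun n => by
    rw [norm_smul, norm_pow, Real.norm_of_nonneg (by norm_num)]
    gcongr
    exact haC' n
  have hsC : Summable fun n => (1 / 2 : ℝ) ^ n * C := summable_geometric_two.mul_right C
  have hs : Summable fun n => ((1 / 2 : ℝ) ^ n) • a n := Summable.of_norm_bounded hsC hbound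
  set s := ∑' n, ((1 / 2 : ℝ) ^ n) • a n with hs_def
  have hterm : ∀ n, 0 ≤ ((1 / 2 : ℝ) ^ n) • a n := fun n => smul_nonneg (by positivity) (ha n)
  have has : ∀ n, ((1 / 2 : ℝ) ^ n) • a n ≤ s := fun n => hs.le_tsum n fun j _ => hterm j
  have hs0 : 0 ≤ s := tsum_nonneg hterm
  have hsnorm : ‖s‖ ≤ 2 * C := by
    refine (tsum_of_norm_bounded hsC.hasSum hbound).trans ?_
    rw [tsum_mul_right, tsum_geometric_two]
  set δ := ε / (8 * C) with hδ
  have hδ0 : 0 < δ := by positivity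
  let v : ℕ → F := fun j => (a j - w j - δ • s)⁺
  have hv0 : ∀ j, 0 ≤ v j := fun j => posPart_nonneg _
  have hva : ∀ j, v j ≤ a j := fun j => by
    refine (posPart_mono ?_).trans (posPart_eq_self.2 (ha j)).le
    rw [sub_sub]
    exact sub_le_self _ (add_nonneg (hw j) (smul_nonneg hδ0.le hs0))
  -- up to a factor, `v i` and `v j` lie below the positive and negative parts of `a i - c • a j`
  have hlt : ∀ i j, i < j → v i ⊓ v j = 0 := by
    intro i j hij
    set c : ℝ := δ * (1 / 2) ^ j with hc
    have hc0 : 0 < c := by positivity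
    have h1 : v i ≤ (a i - c • a j)⁺ := by
      refine posPart_mono ?_
      rw [sub_sub]
      refine sub_le_sub_left ?_ _
      calc c • a j = δ • ((1 / 2 : ℝ) ^ j • a j) := by rw [smul_smul]
        _ ≤ δ • s := smul_le_smul_of_nonneg_left (has j) hδ0.le
        _ ≤ w i + δ • s := le_add_of_nonneg_left (hw i)
    have h2 : v j ≤ c⁻¹ • (c • a j - a i)⁺ := by
      have hcw : c⁻¹ • a i ≤ w j := by
        convert hwa i j hij using 2
        rw [hc, hδ, one_div, inv_pow]
        field_simp
      refine sup_le ?_ (smul_nonneg (by positivity) (posPart_nonneg _))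
      calc a j - w j - δ • s ≤ a j - c⁻¹ • a i :=
            (sub_le_self _ (smul_nonneg hδ0.le hs0)).trans (sub_le_sub_left hcw _)
        _ = c⁻¹ • (c • a j - a i) := by rw [smul_sub, inv_smul_smul₀ hc0.ne']
        _ ≤ c⁻¹ • (c • a j - a i)⁺ :=
            smul_le_smul_of_nonneg_left (le_posPart _) (by positivity)
    have h3 := smul_inf_smul_eq_zero (posPart_nonneg _) (posPart_nonneg _)
      (posPart_sub_inf_posPart_sub (x := a i) (y := c • a j)) zero_le_one (inv_pos.2 hc0).le
    rw [one_smul] at h3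
    exact le_antisymm ((inf_le_inf h1 h2).trans h3.le) (le_inf (hv0 i) (hv0 j))
  refine ⟨v, hv0, fun i j hij => ?_, ⟨ε / 2, by positivity, fun j => ?_⟩, C, fun n => ?_⟩
  · rcases lt_or_gt_of_ne hij with h | h
    · exact hlt i j h
    · rw [inf_comm]
      exact hlt j i h
  · have h1 : a j ≤ v j + a j ⊓ w j + δ • s := by
      have h : a j - w j - δ • s ≤ v j := le_posPart _
      rw [add_inf, inf_add]
      refine le_inf ?_ ?_
      · rw [add_right_comm]
        exact le_add_of_nonneg_left (add_nonneg (hv0 j) (smul_nonneg hδ0.le hs0))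
      · calc a j = (a j - w j - δ • s) + w j + δ • s := by abel
          _ ≤ v j + w j + δ • s := by gcongr
    have h2 : ‖δ • s‖ ≤ ε / 4 := by
      rw [norm_smul, Real.norm_of_nonneg hδ0.le]
      calc δ * ‖s‖ ≤ δ * (2 * C) := by gcongr
        _ = ε / 4 := by rw [hδ]; field_simp; norm_num
    have h3 := norm_le_norm_of_nonneg_of_le (ha j) h1
    have h4 := norm_add₃_le (a := v j) (b := a j ⊓ w j) (c := δ • s)
    linarith [haε j, haw j]
  · exact (norm_le_norm_of_nonneg_of_le (Finset.sum_nonneg fun i _ => hv0 i)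
      (Finset.sum_le_sum fun i _ => hva i)).trans (haC n)

theorem HasOrderContinuousNorm.exists_isC0Sequence [CompleteSpace F]
    (hF : HasOrderContinuousNorm F) {x : ℕ → F} (hx : Monotone x) {C : ℝ}
    (hC : ∀ n, ‖x n‖ ≤ C) (hn : ¬ CauchySeq x) : ∃ v : ℕ → F, IsC0Sequence v := by
  obtain ⟨u, hu, ⟨ε, hε, huε⟩, B, hB⟩ := exists_nonneg_of_not_cauchySeq hx hC hn
  have hB0 : 0 < B := by
    have h := (huε 0).trans (by simpa using norm_sum_range_le hu hB {0})
    linarith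
  obtain ⟨φ, hφ, hφε⟩ := hF.exists_strictMono_inf_lt hu hB
    (fun j => (8 * B / ε) * 2 ^ j) (fun j => by positivity) (show 0 < ε / 4 by positivity)
  have hsum : ∀ n, 0 ≤ ∑ k ∈ Finset.range n, u k := fun n => Finset.sum_nonneg fun i _ => hu i
  refine IsC0Sequence.of_almost_disjoint (a := fun j => u (φ (j + 1)))
    (w := fun j => ((8 * B / ε) * 2 ^ j) • ∑ k ∈ Finset.range (φ j + 1), u k)
    (fun j => hu _) (fun j => smul_nonneg (by positivity) (hsum _)) hB0 hε (fun n => ?_)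
    (fun j => huε _) (fun j => (hφε j).le) fun i j hij => ?_
  · have h := norm_sum_range_le hu hB
      ((Finset.range n).map ⟨fun j => φ (j + 1), fun i j h => by simpa using hφ.injective h⟩)
    rw [Finset.sum_map] at h
    exact h
  · refine smul_le_smul_of_nonneg_left ?_ (by positivity)
    refine Finset.single_le_sum (f := u) (fun k _ => hu k) (Finset.mem_range.2 ?_)
    exact Nat.lt_succ_of_le (hφ.monotone hij)

end C0Sequence

/-! ### The copy of `c₀` spanned by a disjoint sequence -/

section C0Embedding

theorem tendsto_atTop_of_zeroAtInfty (f : C₀(ℕ, ℝ)) : Tendsto f atTop (𝓝 0) := by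
  have h := zero_at_infty f
  rwa [cocompact_eq_cofinite, Nat.cofinite_eq_atTop] at h

/-- The element of `C₀(ℕ, ℝ)` given by a sequence that tends to `0`. -/
def zeroAtInftyOfTendsto (a : ℕ → ℝ) (ha : Tendsto a atTop (𝓝 0)) : C₀(ℕ, ℝ) where
  toFun := a
  continuous_toFun := continuous_of_discreteTopology
  zero_at_infty' := by rwa [cocompact_eq_cofinite, Nat.cofinite_eq_atTop]

theorem abs_apply_le_norm (f : C₀(ℕ, ℝ)) (n : ℕ) : |f n| ≤ ‖f‖ := by
  rw [← ZeroAtInftyContinuousMap.norm_toBCF_eq_norm]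
  exact f.toBCF.norm_coe_le_norm n

theorem norm_le_of_abs_apply_le (f : C₀(ℕ, ℝ)) {B : ℝ} (hB : 0 ≤ B) (h : ∀ n, |f n| ≤ B) :
    ‖f‖ ≤ B := by
  rw [← ZeroAtInftyContinuousMap.norm_toBCF_eq_norm]
  exact (f.toBCF.norm_le hB).2 h

/-- The unit vectors of a sublattice isomorphic to `c₀`. -/
theorem exists_isC0Sequence_of_not_isKBSpace {F : Type u} [NormedAddCommGroup F]
    [Lattice F] [NormedSpace ℝ F] (h : ¬ IsKBSpace F) :
    ∃ v : ℕ → F, IsC0Sequence v := by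
  rw [IsKBSpace, not_not] at h
  obtain ⟨G, hG, e, he⟩ := h
  let δ : ℕ → C₀(ℕ, ℝ) := fun n => zeroAtInftyOfTendsto (Pi.single n 1)
    (tendsto_const_nhds.congr' (by
      filter_upwards [eventually_gt_atTop n] with k hk
      rw [Pi.single_eq_of_ne hk.ne']))
  have hδ : ∀ n k, δ n k = if k = n then 1 else 0 := fun n k => Pi.single_apply n 1 k
  have he0 : ∀ f, (∀ n, 0 ≤ f n) → (0 : F) ≤ e f := fun f hf => by
    have h := (he 0 f).2 (by simpa using hf)
    rw [map_zero] at h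
    exact h
  have hnorm : ∀ n, ‖δ n‖ = 1 := fun n => by
    refine le_antisymm (norm_le_of_abs_apply_le _ zero_le_one fun k => ?_) ?_
    · rw [hδ]
      split_ifs <;> simp
    · simpa [hδ] using abs_apply_le_norm (δ n) n
  refine ⟨fun n => e (δ n), fun n => he0 _ fun k => ?_, fun i j hij => ?_, ?_,
    ‖(e : C₀(ℕ, ℝ) →L[ℝ] G)‖, fun n => ?_⟩
  · rw [hδ]
    split_ifs <;> simp
  · -- the infimum lies in the sublattice, so it comes from some `f` below both unit vectors
    have hmem := (hG _ (e (δ i)).2 _ (e (δ j)).2).2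
    obtain ⟨f, hf⟩ := e.surjective ⟨_, hmem⟩
    have hfF : ((e f : G) : F) = (e (δ i) : F) ⊓ (e (δ j) : F) := congrArg Subtype.val hf
    have hi := (he f (δ i)).1 (by
      change ((e f : G) : F) ≤ _
      rw [hfF]
      exact inf_le_left)
    have hj := (he f (δ j)).1 (by
      change ((e f : G) : F) ≤ _
      rw [hfF]
      exact inf_le_right)
    have hf0 : e f ≤ e 0 := (he f 0).2 fun n => by
      have h1 := hi n
      have h2 := hj n
      rw [hδ] at h1 h2
      split_ifs at h1 h2 with h3 h4
      · exact absurd (h3.symm.trans h4) hij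
      all_goals simpa using (by assumption)
    have hf0' : ((e f : G) : F) ≤ 0 := by
      rw [map_zero] at hf0
      exact hf0
    refine le_antisymm (hfF ▸ hf0') (le_inf (he0 _ fun k => ?_) (he0 _ fun k => ?_)) <;>
    · rw [hδ]
      split_ifs <;> simp
  · set K := ‖(e.symm : G →L[ℝ] C₀(ℕ, ℝ))‖ with hK
    have hK0 : 0 ≤ K := by positivity
    refine ⟨(K + 1)⁻¹, by positivity, fun n => ?_⟩
    have h := (e.symm : G →L[ℝ] C₀(ℕ, ℝ)).le_opNorm (e (δ n))
    rw [ContinuousLinearEquiv.coe_coe, e.symm_apply_apply, hnorm, ← hK, Submodule.coe_norm] at h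
    rw [inv_le_iff_one_le_mul₀' (by positivity)]
    linarith [norm_nonneg (e (δ n) : F)]
  · have hs : ∑ k ∈ Finset.range n, (e (δ k) : F) = e (∑ k ∈ Finset.range n, δ k) := by
      simp
    rw [hs]
    refine ((e : C₀(ℕ, ℝ) →L[ℝ] G).le_opNorm _).trans (mul_le_of_le_one_right (norm_nonneg _) ?_)
    refine norm_le_of_abs_apply_le _ zero_le_one fun k => ?_
    have : (∑ i ∈ Finset.range n, δ i) k = if k < n then 1 else 0 := by
      clear hs
      induction n with
      | zero => simp
      | succ n ih =>
        rw [Finset.sum_range_succ, ZeroAtInftyContinuousMap.add_apply, ih, hδ]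
        split_ifs <;> first | omega | simp
    rw [this]
    split_ifs <;> simp

variable {F : Type u} [NormedAddCommGroup F] [Lattice F] [IsOrderedAddMonoid F] [HasSolidNorm F]
  [NormedSpace ℝ F] [IsOrderedModule ℝ F]

theorem IsC0Sequence.norm_sum_smul_le {v : ℕ → F} (hv : IsC0Sequence v) {C : ℝ}
    (hC : ∀ n, ‖∑ k ∈ Finset.range n, v k‖ ≤ C) {a : ℕ → ℝ} {B : ℝ} (hB : 0 ≤ B) (s : Finset ℕ)
    (ha : ∀ k ∈ s, |a k| ≤ B) : ‖∑ k ∈ s, a k • v k‖ ≤ B * C := by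
  have h : |∑ k ∈ s, a k • v k| ≤ |B • ∑ k ∈ s, v k| := by
    rw [abs_sum_smul s hv.nonneg hv.disjoint,
      abs_of_nonneg (smul_nonneg hB (Finset.sum_nonneg fun i _ => hv.nonneg i)), Finset.smul_sum]
    exact Finset.sum_le_sum fun k hk => smul_le_smul_of_nonneg_right (ha k hk) (hv.nonneg k)
  calc ‖∑ k ∈ s, a k • v k‖ ≤ ‖B • ∑ k ∈ s, v k‖ := norm_le_norm_of_abs_le_abs h
    _ = B * ‖∑ k ∈ s, v k‖ := by rw [norm_smul, Real.norm_of_nonneg hB]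
    _ ≤ B * C := by
      gcongr
      exact norm_sum_range_le hv.nonneg hC s

variable [CompleteSpace F]

theorem IsC0Sequence.summable {v : ℕ → F} (hv : IsC0Sequence v) {a : ℕ → ℝ}
    (ha : Tendsto a atTop (𝓝 0)) : Summable fun k => a k • v k := by
  obtain ⟨C, hC⟩ := hv.exists_norm_sum_le
  have hC0 : 0 ≤ C := (norm_nonneg _).trans (hC 0)
  rw [summable_iff_vanishing_norm]
  intro ε hε
  have hη : 0 < ε / (C + 1) := by positivity
  obtain ⟨N, hN⟩ := Metric.tendsto_atTop.1 ha _ hη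
  refine ⟨Finset.range N, fun t ht => ?_⟩
  have hle := hv.norm_sum_smul_le hC hη.le t (a := a) fun k hk => by
    have hk' : N ≤ k := by
      by_contra h
      exact Finset.disjoint_left.1 ht hk (Finset.mem_range.2 (by omega))
    simpa using (hN k hk').le
  refine hle.trans_lt ?_
  rw [div_mul_eq_mul_div, div_lt_iff₀ (by positivity)]
  nlinarith

theorem IsC0Sequence.norm_tsum_le {v : ℕ → F} (hv : IsC0Sequence v) {C : ℝ}
    (hC : ∀ n, ‖∑ k ∈ Finset.range n, v k‖ ≤ C) {a : ℕ → ℝ}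
    (ha : Tendsto a atTop (𝓝 0)) {B : ℝ} (hB : ∀ k, |a k| ≤ B) : ‖∑' k, a k • v k‖ ≤ B * C :=
  le_of_tendsto' (hv.summable ha).hasSum.norm fun s =>
    hv.norm_sum_smul_le hC ((abs_nonneg _).trans (hB 0)) s fun k _ => hB k

theorem IsC0Sequence.abs_tsum {v : ℕ → F} (hv : IsC0Sequence v) {a : ℕ → ℝ}
    (ha : Tendsto a atTop (𝓝 0)) : |∑' k, a k • v k| = ∑' k, |a k| • v k := by
  have ha' : Tendsto (fun k => |a k|) atTop (𝓝 0) := by simpa using ha.abs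
  have hcont : Continuous fun x : F => |x| := continuous_id.sup continuous_neg
  have h := (hcont.tendsto _).comp (hv.summable ha).hasSum
  refine tendsto_nhds_unique h ?_
  have h' : Tendsto (fun s : Finset ℕ => ∑ k ∈ s, |a k| • v k) atTop (𝓝 (∑' k, |a k| • v k)) :=
    (hv.summable ha').hasSum
  exact h'.congr fun s => (abs_sum_smul s hv.nonneg hv.disjoint a).symm

theorem IsC0Sequence.abs_mul_norm_le {v : ℕ → F} (hv : IsC0Sequence v) {a : ℕ → ℝ}
    (ha : Tendsto a atTop (𝓝 0)) (k : ℕ) : |a k| * ‖v k‖ ≤ ‖∑' k, a k • v k‖ := by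
  have ha' : Tendsto (fun k => |a k|) atTop (𝓝 0) := by simpa using ha.abs
  rw [← norm_abs_eq_norm (∑' k, a k • v k), hv.abs_tsum ha]
  calc |a k| * ‖v k‖ = ‖|a k| • v k‖ := by rw [norm_smul, Real.norm_eq_abs, abs_abs]
    _ ≤ _ := norm_le_norm_of_nonneg_of_le (smul_nonneg (abs_nonneg _) (hv.nonneg k))
      ((hv.summable ha').le_tsum k fun j _ => smul_nonneg (abs_nonneg _) (hv.nonneg j))

/-- The embedding `f ↦ ∑ f k • v k` of `c₀` that a disjoint sequence `v` induces. -/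
noncomputable def IsC0Sequence.embedding {v : ℕ → F} (hv : IsC0Sequence v) :
    C₀(ℕ, ℝ) →ₗ[ℝ] F where
  toFun f := ∑' k, f k • v k
  map_add' f g := by
    rw [← (hv.summable (tendsto_atTop_of_zeroAtInfty f)).tsum_add
      (hv.summable (tendsto_atTop_of_zeroAtInfty g))]
    simp [add_smul]
  map_smul' c f := by
    rw [RingHom.id_apply, ← (hv.summable (tendsto_atTop_of_zeroAtInfty f)).tsum_const_smul]
    simp [smul_smul]

theorem IsC0Sequence.abs_embedding {v : ℕ → F} (hv : IsC0Sequence v) (f : C₀(ℕ, ℝ)) :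
    |hv.embedding f| = hv.embedding (zeroAtInftyOfTendsto (fun k => |f k|)
      (by simpa using (tendsto_atTop_of_zeroAtInfty f).abs)) :=
  hv.abs_tsum (tendsto_atTop_of_zeroAtInfty f)

theorem IsC0Sequence.exists_norm_le_embedding {v : ℕ → F} (hv : IsC0Sequence v) :
    ∃ c : ℝ, ∀ f : C₀(ℕ, ℝ), ‖f‖ ≤ c * ‖hv.embedding f‖ := by
  obtain ⟨ε, hε, h⟩ := hv.exists_le_norm
  refine ⟨ε⁻¹, fun f => norm_le_of_abs_apply_le f (by positivity) fun n => ?_⟩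
  rw [le_inv_mul_iff₀ hε, mul_comm]
  exact (mul_le_mul_of_nonneg_left (h n) (abs_nonneg _)).trans
    (hv.abs_mul_norm_le (tendsto_atTop_of_zeroAtInfty f) n)

theorem IsC0Sequence.embedding_injective {v : ℕ → F} (hv : IsC0Sequence v) :
    Function.Injective hv.embedding := by
  obtain ⟨c, hc⟩ := hv.exists_norm_le_embedding
  refine (injective_iff_map_eq_zero _).2 fun f hf => ?_
  have h := hc f
  rw [hf, norm_zero, mul_zero] at h
  exact norm_le_zero_iff.1 h

theorem IsC0Sequence.nonneg_embedding_iff {v : ℕ → F} (hv : IsC0Sequence v) (f : C₀(ℕ, ℝ)) :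
    0 ≤ hv.embedding f ↔ ∀ n, 0 ≤ f n := by
  refine ⟨fun h n => ?_, fun h => tsum_nonneg fun k => smul_nonneg (h k) (hv.nonneg k)⟩
  have h' := abs_of_nonneg h
  rw [hv.abs_embedding] at h'
  rw [← hv.embedding_injective h']
  exact abs_nonneg (f n)

/-- The closed span of a disjoint sequence equivalent to the basis of `c₀` is a sublattice
isomorphic to `c₀`. -/
theorem IsC0Sequence.not_isKBSpace {v : ℕ → F} (hv : IsC0Sequence v) : ¬ IsKBSpace F := by
  rw [IsKBSpace, not_not]
  obtain ⟨C, hC⟩ := hv.exists_norm_sum_le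
  obtain ⟨c, hc⟩ := hv.exists_norm_le_embedding
  have habs : ∀ x ∈ LinearMap.range hv.embedding, |x| ∈ LinearMap.range hv.embedding := by
    rintro _ ⟨f, rfl⟩
    exact ⟨_, (hv.abs_embedding f).symm⟩
  let e := LinearEquiv.ofInjective hv.embedding hv.embedding_injective
  have he : ∀ f, ((e f : LinearMap.range hv.embedding) : F) = hv.embedding f := fun f =>
    LinearEquiv.ofInjective_apply _ f
  have hto : ∀ f, ‖e f‖ ≤ C * ‖f‖ := fun f => by
    rw [Submodule.coe_norm, he, mul_comm]
    exact hv.norm_tsum_le hC (tendsto_atTop_of_zeroAtInfty f) (abs_apply_le_norm f)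
  have hinv : ∀ x, ‖e.symm x‖ ≤ c * ‖x‖ := fun x => by
    have h := hc (e.symm x)
    rwa [← he, LinearEquiv.apply_symm_apply] at h
  refine ⟨LinearMap.range hv.embedding, fun x hx y hy => ?_,
    e.toContinuousLinearEquivOfBounds C c hto hinv, fun f g => ?_⟩
  · have h2 : ∀ z : F, (2 : ℕ) • z ∈ LinearMap.range hv.embedding →
        z ∈ LinearMap.range hv.embedding := fun z hz => by
      have h := Submodule.smul_mem _ (1 / 2 : ℝ) hz
      rw [← Nat.cast_smul_eq_nsmul ℝ, smul_smul] at h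
      simpa using h
    have hxy := habs _ (Submodule.sub_mem _ hy hx)
    constructor
    · apply h2
      rw [two_nsmul_sup_eq_add_add_abs_sub]
      exact Submodule.add_mem _ (Submodule.add_mem _ hx hy) hxy
    · apply h2
      rw [two_nsmul_inf_eq_add_sub_abs_sub]
      exact Submodule.sub_mem _ (Submodule.add_mem _ hx hy) hxy
  · change ((e f : LinearMap.range hv.embedding) : F) ≤ e g ↔ _
    rw [he, he, ← sub_nonneg, ← map_sub, hv.nonneg_embedding_iff]
    simp

end C0Embedding

/-! ### Coordinate functionals of a disjoint sequence -/

section Functionals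

variable {F : Type u} [NormedAddCommGroup F] [Lattice F]

/-- Positive functionals that are biorthogonal to `v`, uniformly bounded, and tend to `0`
pointwise. They make `x ↦ ∑ g k x • v k` a positive projection onto the copy of `c₀` that `v`
spans. -/
structure IsCoordinateSystem [NormedSpace ℝ F] (v : ℕ → F) (g : ℕ → F →L[ℝ] ℝ) : Prop where
  nonneg : ∀ k x, 0 ≤ x → 0 ≤ g k x
  apply : ∀ k i, g k (v i) = if i = k then 1 else 0
  exists_abs_le : ∃ D : ℝ, ∀ k x, |g k x| ≤ D * ‖x‖
  tendsto_zero : ∀ x, Tendsto (fun k => g k x) atTop (𝓝 0)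

/-- The supremum of `‖x⁺ ⊓ t • v‖` over `t ≥ 0`. If the norm is order continuous, it is the norm of
the component of `x⁺` in the band generated by `v`; this form avoids band projections. -/
noncomputable def bandNorm [NormedSpace ℝ F] (v x : F) : ℝ :=
  ⨆ t : {t : ℝ // 0 ≤ t}, ‖x⁺ ⊓ (t : ℝ) • v‖

theorem bandNorm_le [NormedSpace ℝ F] {v x : F} {B : ℝ} (h : ∀ t : ℝ, 0 ≤ t → ‖x⁺ ⊓ t • v‖ ≤ B) :
    bandNorm v x ≤ B :=
  have : Nonempty {t : ℝ // 0 ≤ t} := ⟨⟨0, le_rfl⟩⟩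
  ciSup_le fun t => h t.1 t.2

variable [IsOrderedAddMonoid F] [HasSolidNorm F] [NormedSpace ℝ F] [IsOrderedModule ℝ F]

theorem norm_posPart_inf_smul_le {v : F} (hv : 0 ≤ v) (x : F) (t : {t : ℝ // 0 ≤ t}) :
    ‖x⁺ ⊓ (t : ℝ) • v‖ ≤ ‖x⁺‖ :=
  norm_le_norm_of_nonneg_of_le (le_inf (posPart_nonneg _) (smul_nonneg t.2 hv)) inf_le_left

theorem bddAbove_norm_posPart_inf_smul {v : F} (hv : 0 ≤ v) (x : F) :
    BddAbove (Set.range fun t : {t : ℝ // 0 ≤ t} => ‖x⁺ ⊓ (t : ℝ) • v‖) :=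
  ⟨‖x⁺‖, by
    rintro _ ⟨t, rfl⟩
    exact norm_posPart_inf_smul_le hv x t⟩

theorem le_bandNorm {v : F} (hv : 0 ≤ v) (x : F) {t : ℝ} (ht : 0 ≤ t) :
    ‖x⁺ ⊓ t • v‖ ≤ bandNorm v x :=
  le_ciSup (bddAbove_norm_posPart_inf_smul hv x) ⟨t, ht⟩

theorem bandNorm_le_norm {v : F} (hv : 0 ≤ v) (x : F) : bandNorm v x ≤ ‖x‖ := by
  refine bandNorm_le fun t ht => (norm_posPart_inf_smul_le hv x ⟨t, ht⟩).trans ?_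
  refine norm_le_norm_of_abs_le_abs ?_
  rw [abs_of_nonneg (posPart_nonneg x)]
  exact sup_le (le_abs_self x) (abs_nonneg x)

theorem bandNorm_add_le {v : F} (hv : 0 ≤ v) (x y : F) :
    bandNorm v (x + y) ≤ bandNorm v x + bandNorm v y := by
  refine bandNorm_le fun t ht => ?_
  have htv : 0 ≤ t • v := smul_nonneg ht hv
  have hxy : (x + y)⁺ ≤ x⁺ + y⁺ :=
    sup_le (add_le_add (le_posPart x) (le_posPart y))
      (add_nonneg (posPart_nonneg x) (posPart_nonneg y))
  calc ‖(x + y)⁺ ⊓ t • v‖ ≤ ‖x⁺ ⊓ t • v + y⁺ ⊓ t • v‖ :=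
        norm_le_norm_of_nonneg_of_le (le_inf (posPart_nonneg _) htv)
          ((inf_le_inf_right _ hxy).trans
            (add_inf_le_inf_add_inf (posPart_nonneg _) (posPart_nonneg _) htv))
    _ ≤ ‖x⁺ ⊓ t • v‖ + ‖y⁺ ⊓ t • v‖ := norm_add_le _ _
    _ ≤ _ := add_le_add (le_bandNorm hv x ht) (le_bandNorm hv y ht)

theorem bandNorm_smul {v : F} (hv : 0 ≤ v) {c : ℝ} (hc : 0 < c) (x : F) :
    bandNorm v (c • x) = c * bandNorm v x := by
  have key : ∀ {c : ℝ}, 0 < c → ∀ x, bandNorm v (c • x) ≤ c * bandNorm v x := by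
    intro c hc x
    refine bandNorm_le fun t ht => ?_
    have h1 : (c • x)⁺ = c • x⁺ := by
      have h := (OrderIso.smulRight hc (β := F)).map_sup x 0
      rw [OrderIso.smulRight_apply, OrderIso.smulRight_apply, OrderIso.smulRight_apply,
        smul_zero] at h
      exact h.symm
    have h2 : t • v = c • ((c⁻¹ * t) • v) := by
      rw [smul_smul, mul_inv_cancel_left₀ hc.ne']
    rw [h1, h2, smul_inf_smul hc, norm_smul, Real.norm_of_nonneg hc.le]
    exact mul_le_mul_of_nonneg_left (le_bandNorm hv x (by positivity)) hc.le
  refine le_antisymm (key hc x) ?_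
  have h := key (inv_pos.2 hc) (c • x)
  rwa [inv_smul_smul₀ hc.ne', le_inv_mul_iff₀ hc] at h

/-- By the Hahn–Banach theorem, with `bandNorm v` as the dominating sublinear functional. -/
theorem exists_functional_le_bandNorm {v : F} (hv : 0 ≤ v) (hv0 : v ≠ 0) :
    ∃ g : F →L[ℝ] ℝ, g v = ‖v‖ ∧ (∀ x, g x ≤ bandNorm v x) ∧ ∀ x, 0 ≤ x → 0 ≤ g x := by
  have hle : ∀ x : (LinearPMap.mkSpanSingleton (K := ℝ) (L := ℝ) (σ := RingHom.id ℝ) v ‖v‖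
      hv0).domain, LinearPMap.mkSpanSingleton (σ := RingHom.id ℝ) v ‖v‖ hv0 x ≤ bandNorm v x := by
    rintro ⟨x, hx⟩
    obtain ⟨c, rfl⟩ := Submodule.mem_span_singleton.1 hx
    have h1 : LinearPMap.mkSpanSingleton (σ := RingHom.id ℝ) v ‖v‖ hv0 ⟨c • v, hx⟩ = c * ‖v‖ :=
      LinearPMap.mkSpanSingleton'_apply _ _ _ _ _
    rw [h1]
    rcases le_or_gt 0 c with hc | hc
    · have h := le_bandNorm hv (c • v) hc
      rwa [posPart_eq_self.2 (smul_nonneg hc hv), inf_idem, norm_smul, Real.norm_of_nonneg hc] at h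
    · exact (mul_nonpos_of_nonpos_of_nonneg hc.le (norm_nonneg v)).trans
        ((norm_nonneg _).trans (le_bandNorm hv (c • v) le_rfl))
  obtain ⟨g, hg1, hg2⟩ := exists_extension_of_le_sublinear _ (bandNorm v)
    (fun c hc x => bandNorm_smul hv hc x) (bandNorm_add_le hv) hle
  have hgn : ∀ x, ‖g x‖ ≤ 1 * ‖x‖ := fun x => by
    rw [one_mul, Real.norm_eq_abs, abs_le']
    refine ⟨(hg2 x).trans (bandNorm_le_norm hv x), ?_⟩
    rw [← map_neg, ← norm_neg x]
    exact (hg2 _).trans (bandNorm_le_norm hv _)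
  refine ⟨g.mkContinuous 1 hgn, ?_, hg2, fun x hx => ?_⟩
  · have h := hg1 ⟨v, Submodule.mem_span_singleton_self v⟩
    rw [LinearPMap.mkSpanSingleton_apply] at h
    exact h
  · have h : g (-x) ≤ 0 := (hg2 (-x)).trans (bandNorm_le fun t ht => by
      rw [posPart_eq_zero.2 (neg_nonpos.2 hx), inf_eq_left.2 (smul_nonneg ht hv), norm_zero])
    rw [map_neg] at h
    exact neg_nonpos.1 h

theorem HasOrderContinuousNorm.tendsto_bandNorm (hF : HasOrderContinuousNorm F) {v : ℕ → F}
    (hv : ∀ n, 0 ≤ v n) (hd : ∀ i j, i ≠ j → v i ⊓ v j = 0) (x : F) :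
    Tendsto (fun k => bandNorm (v k) x) atTop (𝓝 0) := by
  have hex : ∀ k : ℕ, ∃ t : ℝ, 0 ≤ t ∧
      bandNorm (v k) x ≤ ‖x⁺ ⊓ t • v k‖ + 1 / ((k : ℝ) + 1) := by
    intro k
    by_contra! h
    have h1 : bandNorm (v k) x ≤ bandNorm (v k) x - 1 / ((k : ℝ) + 1) :=
      bandNorm_le fun t ht => by linarith [h t ht]
    have h2 : (0 : ℝ) < 1 / ((k : ℝ) + 1) := by positivity
    linarith
  choose t ht hle using hex
  have hnn : ∀ k, 0 ≤ x⁺ ⊓ t k • v k := fun k =>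
    le_inf (posPart_nonneg x) (smul_nonneg (ht k) (hv k))
  have hlim : Tendsto (fun k => x⁺ ⊓ t k • v k) atTop (𝓝 0) := by
    refine hF.tendsto_zero_of_disjoint hnn (fun i j hij => ?_) (fun k => inf_le_left)
    refine le_antisymm ((inf_le_inf inf_le_right inf_le_right).trans ?_) (le_inf (hnn i) (hnn j))
    exact (smul_inf_smul_eq_zero (hv i) (hv j) (hd i j hij) (ht i) (ht j)).le
  have hlim' := hlim.norm.add (tendsto_one_div_add_atTop_nhds_zero_nat (𝕜 := ℝ))
  rw [norm_zero, add_zero] at hlim'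
  exact squeeze_zero (fun k => (norm_nonneg _).trans (le_bandNorm (hv k) x le_rfl)) hle hlim'

theorem IsC0Sequence.exists_isCoordinateSystem {v : ℕ → F} (hv : IsC0Sequence v)
    (hF : HasOrderContinuousNorm F) : ∃ g : ℕ → F →L[ℝ] ℝ, IsCoordinateSystem v g := by
  obtain ⟨ε, hε, hεv⟩ := hv.exists_le_norm
  have hpos : ∀ k, 0 < ‖v k‖ := fun k => hε.trans_le (hεv k)
  choose g hg1 hg2 hg3 using fun k =>
    exists_functional_le_bandNorm (hv.nonneg k) (norm_pos_iff.1 (hpos k))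
  have habs : ∀ k x, |‖v k‖⁻¹ * g k x| ≤ ε⁻¹ * bandNorm (v k) |x| := by
    intro k x
    have h : |g k x| ≤ g k |x| := by
      rw [abs_le']
      constructor
      · rw [← sub_nonneg, ← map_sub]
        exact hg3 k _ (sub_nonneg.2 (le_abs_self x))
      · rw [← sub_nonneg, sub_neg_eq_add, ← map_add]
        refine hg3 k _ ?_
        rw [add_comm]
        exact neg_le_iff_add_nonneg'.1 (neg_le_abs x)
    rw [abs_mul, abs_of_pos (inv_pos.2 (hpos k))]
    have h' := h.trans (hg2 k |x|)
    have h'' := inv_anti₀ hε (hεv k)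
    gcongr
  refine ⟨fun k => ‖v k‖⁻¹ • g k, fun k x hx => ?_, fun k i => ?_, ⟨ε⁻¹, fun k x => ?_⟩,
    fun x => ?_⟩
  · exact mul_nonneg (inv_nonneg.2 (norm_nonneg _)) (hg3 k x hx)
  · change ‖v k‖⁻¹ * g k (v i) = _
    split_ifs with h
    · rw [h, hg1, inv_mul_cancel₀ (hpos k).ne']
    · have h0 : g k (v i) = 0 := by
        refine le_antisymm ((hg2 k _).trans (bandNorm_le fun t ht => ?_)) (hg3 k _ (hv.nonneg i))
        have h1 := smul_inf_smul_eq_zero (hv.nonneg i) (hv.nonneg k) (hv.disjoint i k h)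
          zero_le_one ht
        rw [one_smul] at h1
        rw [posPart_eq_self.2 (hv.nonneg i), h1, norm_zero]
      rw [h0, mul_zero]
  · refine (habs k x).trans (mul_le_mul_of_nonneg_left ?_ (by positivity))
    rw [← norm_abs_eq_norm x]
    exact bandNorm_le_norm (hv.nonneg k) _
  · have h := (hF.tendsto_bandNorm hv.nonneg hv.disjoint |x|).const_mul ε⁻¹
    rw [mul_zero] at h
    exact squeeze_zero_norm (fun k => habs k x) h

end Functionals

/-! ### A filtration with a bounded martingale that is not regular -/

/-- The involution of `ℕ` that exchanges `2 k` and `2 k + 1`. -/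
def pairSwap (k : ℕ) : ℕ := if k % 2 = 0 then k + 1 else k - 1

theorem pairSwap_pairSwap (k : ℕ) : pairSwap (pairSwap k) = k := by
  unfold pairSwap; split_ifs <;> omega

theorem pairSwap_lt_iff (k n : ℕ) : pairSwap k < 2 * n ↔ k < 2 * n := by
  unfold pairSwap; split_ifs <;> omega

theorem neg_one_pow_pairSwap (k : ℕ) : (-1 : ℝ) ^ pairSwap k = -(-1) ^ k := by
  unfold pairSwap
  split_ifs with h
  · rw [pow_succ]; ring
  · obtain ⟨m, rfl⟩ : ∃ m, k = m + 1 := ⟨k - 1, by omega⟩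
    rw [Nat.add_sub_cancel, pow_succ]; ring

theorem tendsto_pairSwap : Tendsto pairSwap atTop atTop :=
  tendsto_atTop_mono (fun k => show k - 1 ≤ pairSwap k by unfold pairSwap; split_ifs <;> omega)
    (tendsto_sub_atTop_nat 1)

/-- The operator that replaces `a (2 k)` and `a (2 k + 1)` by their average for all `k ≥ n`. -/
noncomputable def pairAverage (n : ℕ) (a : ℕ → ℝ) (k : ℕ) : ℝ :=
  if k < 2 * n then a k else (a k + a (pairSwap k)) / 2

theorem pairAverage_pairAverage (n m : ℕ) (a : ℕ → ℝ) :
    pairAverage n (pairAverage m a) = pairAverage (min n m) a := by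
  funext k
  simp only [pairAverage, pairSwap_pairSwap, pairSwap_lt_iff]
  split_ifs <;> first | omega | ring

theorem tendsto_pairAverage (n : ℕ) {a : ℕ → ℝ} (ha : Tendsto a atTop (𝓝 0)) :
    Tendsto (pairAverage n a) atTop (𝓝 0) := by
  have h : Tendsto (fun k => (a k + a (pairSwap k)) / 2) atTop (𝓝 0) := by
    simpa using (ha.add (ha.comp tendsto_pairSwap)).div_const 2
  refine h.congr' ?_
  filter_upwards [eventually_ge_atTop (2 * n)] with k hk
  rw [pairAverage, if_neg (by omega)]

theorem abs_pairAverage_le (n : ℕ) {a : ℕ → ℝ} {B : ℝ} (ha : ∀ k, |a k| ≤ B) (k : ℕ) :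
    |pairAverage n a k| ≤ B := by
  unfold pairAverage
  split_ifs
  · exact ha k
  · rw [abs_div, abs_two, div_le_iff₀ two_pos]
    linarith [abs_add_le (a k) (a (pairSwap k)), ha k, ha (pairSwap k)]

theorem pairAverage_nonneg (n : ℕ) {a : ℕ → ℝ} (ha : ∀ k, 0 ≤ a k) (k : ℕ) :
    0 ≤ pairAverage n a k := by
  unfold pairAverage
  split_ifs
  · exact ha k
  · linarith [ha k, ha (pairSwap k)]

theorem pairAverage_alternating {n m : ℕ} (h : n ≤ m) :
    pairAverage n (fun k => if k < 2 * m then (-1 : ℝ) ^ k else 0) =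
      fun k => if k < 2 * n then (-1 : ℝ) ^ k else 0 := by
  funext k
  simp only [pairAverage, pairSwap_lt_iff, neg_one_pow_pairSwap]
  split_ifs <;> first | omega | simp

section Filtration

variable {F : Type u} [NormedAddCommGroup F] [Lattice F] [IsOrderedAddMonoid F] [HasSolidNorm F]
  [NormedSpace ℝ F] [IsOrderedModule ℝ F] [CompleteSpace F]

/-- The projections `x ↦ ∑ pairAverage n (g · x) k • v k`: the positive projection onto the
closed span of `v`, followed by the averaging of all but the first `n` pairs of coordinates. -/
noncomputable def pairFiltration {v : ℕ → F} {g : ℕ → F →L[ℝ] ℝ} (hv : IsC0Sequence v)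
    (hg : IsCoordinateSystem v g) (n : ℕ) : F →ₗ[ℝ] F where
  toFun x := ∑' k, pairAverage n (fun j => g j x) k • v k
  map_add' x y := by
    rw [← (hv.summable (tendsto_pairAverage n (hg.tendsto_zero x))).tsum_add
      (hv.summable (tendsto_pairAverage n (hg.tendsto_zero y)))]
    refine tsum_congr fun k => ?_
    rw [← add_smul]
    congr 1
    simp only [pairAverage, map_add]
    split_ifs <;> ring
  map_smul' c x := by
    rw [RingHom.id_apply,
      ← (hv.summable (tendsto_pairAverage n (hg.tendsto_zero x))).tsum_const_smul]
    refine tsum_congr fun k => ?_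
    rw [smul_smul]
    congr 1
    simp only [pairAverage, map_smul, smul_eq_mul]
    split_ifs <;> ring

theorem pairFiltration_apply {v : ℕ → F} {g : ℕ → F →L[ℝ] ℝ} (hv : IsC0Sequence v)
    (hg : IsCoordinateSystem v g) (n : ℕ) (x : F) :
    pairFiltration hv hg n x = ∑' k, pairAverage n (fun j => g j x) k • v k := rfl

theorem IsCoordinateSystem.apply_tsum {v : ℕ → F} {g : ℕ → F →L[ℝ] ℝ} (hv : IsC0Sequence v)
    (hg : IsCoordinateSystem v g) {a : ℕ → ℝ} (ha : Tendsto a atTop (𝓝 0)) (j : ℕ) :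
    g j (∑' k, a k • v k) = a j := by
  rw [(g j).map_tsum (hv.summable ha), tsum_eq_single j]
  · simp [hg.apply]
  · intro k hk
    simp [hg.apply, hk]

theorem apply_pairFiltration {v : ℕ → F} {g : ℕ → F →L[ℝ] ℝ} (hv : IsC0Sequence v)
    (hg : IsCoordinateSystem v g) (n : ℕ) (x : F) (j : ℕ) :
    g j (pairFiltration hv hg n x) = pairAverage n (fun i => g i x) j :=
  hg.apply_tsum hv (tendsto_pairAverage n (hg.tendsto_zero x)) j

theorem isFiltration_pairFiltration {v : ℕ → F} {g : ℕ → F →L[ℝ] ℝ} (hv : IsC0Sequence v)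
    (hg : IsCoordinateSystem v g) : IsFiltration (pairFiltration hv hg) := by
  have hcomp : ∀ n m x, pairFiltration hv hg n (pairFiltration hv hg m x) =
      pairFiltration hv hg (min n m) x := fun n m x => by
    rw [pairFiltration_apply, pairFiltration_apply hv hg (min n m), ← pairAverage_pairAverage]
    simp only [apply_pairFiltration]
  refine ⟨fun n x hx => tsum_nonneg fun k => smul_nonneg ?_ (hv.nonneg k), fun n x => ?_, hcomp⟩
  · exact pairAverage_nonneg n (fun j => hg.nonneg j x hx) k
  · rw [hcomp, min_self]

theorem isUniformlyBounded_pairFiltration {v : ℕ → F} {g : ℕ → F →L[ℝ] ℝ} (hv : IsC0Sequence v)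
    (hg : IsCoordinateSystem v g) : IsUniformlyBounded (pairFiltration hv hg) := by
  obtain ⟨C, hC⟩ := hv.exists_norm_sum_le
  obtain ⟨D, hD⟩ := hg.exists_abs_le
  refine ⟨D * C, fun n x => ?_⟩
  calc ‖pairFiltration hv hg n x‖ ≤ (D * ‖x‖) * C :=
        hv.norm_tsum_le hC (tendsto_pairAverage n (hg.tendsto_zero x))
          (abs_pairAverage_le n fun k => hD k x)
    _ = D * C * ‖x‖ := by ring

theorem alternating_mem_boundedMartingales {v : ℕ → F} {g : ℕ → F →L[ℝ] ℝ} (hv : IsC0Sequence v)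
    (hg : IsCoordinateSystem v g) :
    (fun m => ∑ k ∈ Finset.range (2 * m), (-1 : ℝ) ^ k • v k) ∈
      boundedMartingales (pairFiltration hv hg) := by
  have hsum : ∀ m, ∑' k, (if k < 2 * m then (-1 : ℝ) ^ k else 0) • v k =
      ∑ k ∈ Finset.range (2 * m), (-1 : ℝ) ^ k • v k := fun m => by
    rw [tsum_eq_sum (s := Finset.range (2 * m))]
    · exact Finset.sum_congr rfl fun k hk => by rw [if_pos (Finset.mem_range.1 hk)]
    · intro k hk
      rw [if_neg (by simpa using hk), zero_smul]
  have hlim : ∀ m, Tendsto (fun k => if k < 2 * m then (-1 : ℝ) ^ k else 0) atTop (𝓝 0) :=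
    fun m => tendsto_const_nhds.congr' (by
      filter_upwards [eventually_ge_atTop (2 * m)] with k hk
      rw [if_neg (by omega)])
  obtain ⟨C, hC⟩ := hv.exists_norm_sum_le
  refine ⟨fun n m hnm => ?_, 1 * C, fun m => ?_⟩
  · change pairFiltration hv hg n (∑ k ∈ Finset.range (2 * m), (-1 : ℝ) ^ k • v k) = _
    rw [← hsum, pairFiltration_apply]
    simp only [hg.apply_tsum hv (hlim m)]
    rw [pairAverage_alternating hnm, hsum]
  · exact hv.norm_sum_smul_le hC zero_le_one _ fun k _ => by simp

/-- The martingale `∑_{k < 2 m} (-1)ᵏ v k` is bounded, but a positive martingale that dominates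
it must start with an element all of whose coordinates are at least `1 / 2`. -/
theorem IsC0Sequence.exists_not_regular {v : ℕ → F} (hv : IsC0Sequence v)
    (hF : HasOrderContinuousNorm F) : ∃ E : ℕ → F →ₗ[ℝ] F, IsFiltration E ∧
      IsUniformlyBounded E ∧
      (boundedMartingales E : Set (ℕ → F)) ≠ regularBoundedMartingales E := by
  obtain ⟨g, hg⟩ := hv.exists_isCoordinateSystem hF
  refine ⟨pairFiltration hv hg, isFiltration_pairFiltration hv hg,
    isUniformlyBounded_pairFiltration hv hg, fun h => ?_⟩
  have hX := alternating_mem_boundedMartingales hv hg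
  rw [← SetLike.mem_coe, h] at hX
  obtain ⟨Y, hY, Z, hZ, hY0, hZ0, hYZ⟩ := hX
  have hcoord : ∀ k m, k < 2 * m → (-1 : ℝ) ^ k ≤ g k (Y m) := fun k m hk => by
    have h1 : g k (∑ k ∈ Finset.range (2 * m), (-1 : ℝ) ^ k • v k) = (-1) ^ k := by
      simp [map_sum, hg.apply, hk]
    have h2 := congrFun hYZ m
    rw [h2, Pi.sub_apply, map_sub] at h1
    linarith [hg.nonneg k _ (hZ0 m)]
  have hhalf : ∀ k, 1 / 2 ≤ g k (Y 0) := fun k => by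
    have hk : k < 2 * (k + 1) := by omega
    have h1 : g k (Y 0) = (g k (Y (k + 1)) + g (pairSwap k) (Y (k + 1))) / 2 := by
      rw [← hY.1 0 (k + 1) (Nat.zero_le _), apply_pairFiltration]
      simp [pairAverage]
    have h2 := hcoord k (k + 1) hk
    have h3 := hcoord (pairSwap k) (k + 1) ((pairSwap_lt_iff _ _).2 hk)
    have h4 := hg.nonneg k _ (hY0 (k + 1))
    have h5 := hg.nonneg (pairSwap k) _ (hY0 (k + 1))
    rw [neg_one_pow_pairSwap] at h3
    rcases neg_one_pow_eq_or ℝ k with h6 | h6 <;> rw [h6] at h2 h3 <;> rw [h1] <;> linarith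
  have hlim := ge_of_tendsto' (hg.tendsto_zero (Y 0)) hhalf
  norm_num at hlim

end Filtration

/-! ### Suprema of bounded martingales in KB-spaces -/

section Supremum

variable {F : Type u} [NormedAddCommGroup F] [Lattice F] [IsOrderedAddMonoid F] [HasSolidNorm F]
  [NormedSpace ℝ F] [CompleteSpace F]

theorem IsFiltration.monotone {F : Type u} [AddCommGroup F] [Lattice F] [IsOrderedAddMonoid F]
    [Module ℝ F] {E : ℕ → F →ₗ[ℝ] F} (hE : IsFiltration E) (n : ℕ) : Monotone (E n) :=
  fun x y h => by
    rw [← sub_nonneg, ← map_sub]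
    exact hE.positive n _ (sub_nonneg.2 h)

/-- The supremum of bounded martingales `X` and `Y` has as its `n`-th term the limit, as
`m → ∞`, of the increasing sequence `E n (X m ⊔ Y m)`. -/
theorem exists_isLUB_boundedMartingales
    (hmono : ∀ x : ℕ → F, Monotone x → (∃ C : ℝ, ∀ n, ‖x n‖ ≤ C) → CauchySeq x)
    {E : ℕ → F →ₗ[ℝ] F} (hE : IsFiltration E) (hb : IsUniformlyBounded E)
    (X Y : boundedMartingales E) : ∃ Z, IsLUB {X, Y} Z := by
  obtain ⟨X, hX, A, hA⟩ := X
  obtain ⟨Y, hY, B, hB⟩ := Y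
  obtain ⟨C, hC⟩ := hb
  have hC' : ∀ n x, ‖E n x‖ ≤ |C| * ‖x‖ := fun n x =>
    (hC n x).trans (mul_le_mul_of_nonneg_right (le_abs_self C) (norm_nonneg x))
  have hcont : ∀ n, Continuous (E n) := fun n =>
    AddMonoidHomClass.continuous_of_bound (E n) C (hC n)
  have hbound : ∀ n m, ‖E n (X m ⊔ Y m)‖ ≤ |C| * (A + B) := fun n m =>
    (hC' n _).trans (mul_le_mul_of_nonneg_left
      ((norm_sup_le_add _ _).trans (add_le_add (hA m) (hB m))) (abs_nonneg C))
  -- `E n (X m ⊔ Y m)` increases in `m` only from `m = n` on, hence the shift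
  have hinc : ∀ n, Monotone fun k => E n (X (n + k) ⊔ Y (n + k)) := fun n =>
    monotone_nat_of_le_succ fun k => by
      have h1 : X (n + k) ⊔ Y (n + k) ≤ E (n + k) (X (n + (k + 1)) ⊔ Y (n + (k + 1))) := by
        rw [← hX (n + k) (n + (k + 1)) (by omega), ← hY (n + k) (n + (k + 1)) (by omega)]
        exact sup_le (hE.monotone _ le_sup_left) (hE.monotone _ le_sup_right)
      have h2 := hE.monotone n h1
      rwa [hE.comp, min_eq_left (by omega)] at h2
  have hlim : ∀ n, ∃ z, Tendsto (fun m => E n (X m ⊔ Y m)) atTop (𝓝 z) := fun n => by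
    obtain ⟨z, hz⟩ := cauchySeq_tendsto_of_complete
      (hmono _ (hinc n) ⟨_, fun k => hbound n (n + k)⟩)
    refine ⟨z, (tendsto_add_atTop_iff_nat n).1 ?_⟩
    simpa only [add_comm n] using hz
  choose Z hZ using hlim
  have hmart : IsMartingale E Z := fun n m hnm => by
    refine tendsto_nhds_unique (((hcont n).tendsto _).comp (hZ m)) ?_
    refine (hZ n).congr fun k => ?_
    rw [Function.comp_apply, hE.comp, min_eq_left hnm]
  have hZmem : Z ∈ boundedMartingales E :=
    ⟨hmart, |C| * (A + B), fun n => le_of_tendsto' (hZ n).norm fun m => hbound n m⟩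
  refine ⟨⟨Z, hZmem⟩, ?_, ?_⟩
  · rintro W (rfl | rfl) n
    · refine ge_of_tendsto (hZ n) ?_
      filter_upwards [eventually_ge_atTop n] with m hm
      change X n ≤ _
      rw [← hX n m hm]
      exact hE.monotone n le_sup_left
    · refine ge_of_tendsto (hZ n) ?_
      filter_upwards [eventually_ge_atTop n] with m hm
      change Y n ≤ _
      rw [← hY n m hm]
      exact hE.monotone n le_sup_right
  · intro W hW n
    have hXW : X ≤ W.1 := hW (Set.mem_insert _ _)
    have hYW : Y ≤ W.1 := hW (Set.mem_insert_of_mem _ rfl)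
    refine le_of_tendsto (hZ n) ?_
    filter_upwards [eventually_ge_atTop n] with m hm
    rw [← W.2.1 n m hm]
    exact hE.monotone n (sup_le (hXW m) (hYW m))

end Supremum

theorem isVectorLattice_of_exists_isLUB {W : Type u} [AddCommGroup W] [PartialOrder W]
    [IsOrderedAddMonoid W] [Module ℝ W] (V : Submodule ℝ W)
    (h : ∀ X Y : V, ∃ Z, IsLUB {X, Y} Z) : IsVectorLattice V := by
  refine fun X Y => ⟨h X Y, ?_⟩
  obtain ⟨Z, hZ⟩ := h (-X) (-Y)
  refine ⟨-Z, ?_, fun T hT => ?_⟩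
  · rintro T (rfl | rfl)
    · exact neg_le.1 (hZ.1 (Set.mem_insert _ _))
    · exact neg_le.1 (hZ.1 (Set.mem_insert_of_mem _ rfl))
  · refine le_neg.1 (hZ.2 ?_)
    rintro U (rfl | rfl)
    · exact neg_le_neg (hT (Set.mem_insert _ _))
    · exact neg_le_neg (hT (Set.mem_insert_of_mem _ rfl))

theorem eq_regular_of_isVectorLattice {F : Type u} [NormedAddCommGroup F] [Lattice F]
    [IsOrderedAddMonoid F] [NormedSpace ℝ F] {E : ℕ → F →ₗ[ℝ] F}
    (h : IsVectorLattice (boundedMartingales E)) :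
    (boundedMartingales E : Set (ℕ → F)) = regularBoundedMartingales E := by
  ext X
  constructor
  · intro hX
    obtain ⟨Z, hZ⟩ := (h ⟨X, hX⟩ 0).1
    have hXZ : X ≤ Z.1 := hZ.1 (Set.mem_insert _ _)
    have h0Z : 0 ≤ Z.1 := hZ.1 (Set.mem_insert_of_mem _ rfl)
    exact ⟨Z, Z.2, Z - X, Submodule.sub_mem _ Z.2 hX, h0Z, sub_nonneg.2 hXZ,
      (sub_sub_cancel _ _).symm⟩
  · rintro ⟨Y, hY, Z, hZ, -, -, rfl⟩
    exact Submodule.sub_mem _ hY hZ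

end AbstractMartingale

theorem theorem12 {F : Type u} [NormedAddCommGroup F] [NormedSpace ℝ F] [CompleteSpace F]
    [Lattice F] [IsOrderedAddMonoid F] [IsOrderedModule ℝ F] [HasSolidNorm F]
    (hF : AbstractMartingale.HasOrderContinuousNorm F) :
    List.TFAE
      [AbstractMartingale.IsKBSpace F,
       ∀ E : ℕ → F →ₗ[ℝ] F, AbstractMartingale.IsFiltration E →
         AbstractMartingale.IsUniformlyBounded E →
         (AbstractMartingale.boundedMartingales E : Set (ℕ → F)) =
           AbstractMartingale.regularBoundedMartingales E,
       ∀ E : ℕ → F →ₗ[ℝ] F, AbstractMartingale.IsFiltration E →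
         AbstractMartingale.IsUniformlyBounded E →
         AbstractMartingale.IsVectorLattice (AbstractMartingale.boundedMartingales E)] := by
  tfae_have 1 → 3 := fun hKB E hE hb => by
    refine AbstractMartingale.isVectorLattice_of_exists_isLUB _
      (AbstractMartingale.exists_isLUB_boundedMartingales (fun x hx ⟨C, hC⟩ => ?_) hE hb)
    by_contra hn
    obtain ⟨v, hv⟩ := hF.exists_isC0Sequence hx hC hn
    exact hv.not_isKBSpace hKB
  tfae_have 3 → 2 := fun h E hE hb =>
    AbstractMartingale.eq_regular_of_isVectorLattice (h E hE hb)
  tfae_have 2 → 1 := fun h => by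
    by_contra hKB
    obtain ⟨v, hv⟩ := AbstractMartingale.exists_isC0Sequence_of_not_isKBSpace hKB
    obtain ⟨E, hE, hb, hne⟩ := hv.exists_not_regular hF
    exact hne (h E hE hb)
  tfae_finish
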